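/- Conventions. Let $d=-A^{-2}-A^{2}\in\mathbb Z[A,A^{-1}]$, and let $\langle D\rangle\in\mathbb Z[A,A^{-1}]$ be the Kauffman bracket of a link diagram $D$: $\langle D\rangle=A\langle D_+\rangle+A^{-1}\langle D_-\rangle$ for the positive and negative smoothings of a crossing, and $\langle D\rangle=d^{\,n-1}$ if $D$ consists of $n$ disjoint simple closed curves. Two crossings of a diagram are twist equivalent if some circle in the plane of projection meets the diagram in exactly these two crossings. The twist number of a diagram is the number of classes of the equivalence relation that this generates on the crossings, and the twist number of a link is the minimum of the twist numbers of its diagrams. A diagram is twist-reduced if any two twist equivalent crossings are connected by a chain of bigons. Let $G$ be a connected finite plane multigraph with ordered edges $e_1,\dots,e_k$, each of which is coloured as a chain or as a sheaf. For $t\in\mathbb Z^k$ let $D_t$ be the following link diagram: replace every chain $e_i$ by $|t_i|$ edges in series and every sheaf $e_i$ by $|t_i|$ parallel edges, all of sign $\operatorname{sign}(t_i)$ (if $t_i=0$, a chain is contracted, in the plane, and a sheaf is deleted), and take the link diagram whose checkerboard graph is the resulting signed plane graph; that is, the shaded regions are its vertices, each edge becomes a crossing, and at the crossing of a positive (negative)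 edge the positive smoothing joins (separates) the two shaded regions. $G$ is the template graph of a diagram $D$ if $D=D_{t_0}$ for some $t_0\in(\mathbb Z\setminus\{0\})^k$ such that the edges of $G$ correspond to the full chains and sheaves of $D$, i.e. two crossings of $D$ come from the same edge of $G$ if and only if they are connected by a chain of bigons. Theorem. Let $L$ be a link with a twist-reduced diagram $D$ whose twist number equals the twist number of $L$, and let $G$ be a template graph of $D$, with $k$ edges. For a spanning tree $F$ of $G$ let $$p_F=\#\{\text{sheaves in }F\}+\#\{\text{chains not in }F\},\qquad p=\max_F p_F .$$ Put $r_i=t_i$ if $e_i$ is a chain and $r_i=-t_i$ if $e_i$ is a sheaf. Then there is one polynomial $P(A,x_1,\dots,x_k)\in\mathbb Z[A,A^{-1}][x_1,\dots,x_k]$ such that, for every $t\in\mathbb Z^k$, $$d^{\,p}\,\langle D_t\rangle = A^{r_1+\dots+r_k}\;P\bigl(A,(-A^{-4})^{r_1},\dots,(-A^{-4})^{r_k}\bigr).$$ Furthermore, $p$ is at most the twist number of $L$. -/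

import Mathlib

open scoped LaurentPolynomial

noncomputable section

namespace TwistBracket

/-! # Link diagrams -/

/-- A planar diagram code. `X` is the set of crossings and `A` the set of arcs (edges of the
underlying 4-valent graph). Going counterclockwise around a crossing `x`, starting from an end of
the under-strand, one meets the arcs `arc x 0, arc x 1, arc x 2, arc x 3`; hence the under-strand
has the ends `0, 2` and the over-strand the ends `1, 3`. An arc that occurs at no crossing is a
simple closed curve without crossings. -/
structure PDCode where
  X : Type
  A : Type
  arc : X → Fin 4 → A
  [fintypeX : Fintype X]
  [finiteA : Finite A]

attribute [instance] PDCode.fintypeX PDCode.finiteA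

namespace PDCode

variable (D : PDCode)

/-- The corner `(x, i)` is the one at `x` between the ends `i` and `i + 1` (counterclockwise). Two
corners are adjacent if they lie next to each other on the same side of an arc whose two ends are
`(x, i)` and `(y, j)`. -/
def CornerAdj (c c' : D.X × Fin 4) : Prop :=
  ∃ x i y j, (x, i) ≠ (y, j) ∧ D.arc x i = D.arc y j ∧ c = (x, i) ∧ c' = (y, j - 1)

/-- The faces of the diagram (complementary regions in the sphere, one sphere for each connected
piece that has crossings). -/
def Face : Type := Quot D.CornerAdj

/-- The face in which a corner lies. -/
def face (x : D.X) (i : Fin 4) : D.Face := Quot.mk _ (x, i)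

/-- Two crossings joined by an arc. -/
def CrossingAdj (x y : D.X) : Prop := ∃ i j, D.arc x i = D.arc y j

/-- Every arc has two ends, or none if it is a closed curve without crossings. -/
def TwoEnds : Prop :=
  ∀ a : D.A, Nat.card {e : D.X × Fin 4 // D.arc e.1 e.2 = a} = 0 ∨
    Nat.card {e : D.X × Fin 4 // D.arc e.1 e.2 = a} = 2

/-- Euler's formula `#vertices - #edges + #faces = 2 #components` for the underlying 4-valent
graph (which has `2 #X` edges): the code is drawn in the plane. -/
def Planar : Prop :=
  Nat.card D.Face = Fintype.card D.X + 2 * Nat.card (Quot D.CrossingAdj)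

/-- Isomorphism of codes: a renaming of crossings and arcs, where at each crossing either end of
the under-strand may be listed first. -/
structure Iso (D D' : PDCode) where
  crossings : D.X ≃ D'.X
  arcs : D.A ≃ D'.A
  turn : D.X → Bool
  arc_eq : ∀ x i, arcs (D.arc x i) = D'.arc (crossings x) (i + if turn x then 2 else 0)

/-! ## The Kauffman bracket -/

/-- The arcs that are joined at the crossings in the state `S`, in which the crossings in `S` get
the positive smoothing and the other crossings the negative one. The positive smoothing joins the
two regions that the over-strand sweeps out when it is rotated counterclockwise (the corners `1`
and `3`), so it connects the end `0` to `1` and `2` to `3`. -/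
def Joined (S : Finset D.X) (a b : D.A) : Prop :=
  (∃ x ∈ S, (a = D.arc x 0 ∧ b = D.arc x 1) ∨ (a = D.arc x 2 ∧ b = D.arc x 3)) ∨
  (∃ x ∉ S, (a = D.arc x 1 ∧ b = D.arc x 2) ∨ (a = D.arc x 3 ∧ b = D.arc x 0))

/-- The number of simple closed curves in a state. -/
def circles (S : Finset D.X) : ℕ := Nat.card (Quot (D.Joined S))

end PDCode

/-- `d = -A⁻² - A²` in `ℤ[A, A⁻¹]`; the variable `A` is `T 1`. -/
def d : ℤ[T;T⁻¹] := -LaurentPolynomial.T (-2) - LaurentPolynomial.T 2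

/-- The Kauffman bracket, determined by `⟨D⟩ = A ⟨D₊⟩ + A⁻¹ ⟨D₋⟩` and
`⟨n disjoint simple closed curves⟩ = d ^ (n - 1)`, as the sum over all states. -/
def PDCode.bracket (D : PDCode) : ℤ[T;T⁻¹] :=
  ∑ S : Finset D.X,
    LaurentPolynomial.T (2 * (S.card : ℤ) - Fintype.card D.X) * d ^ (D.circles S - 1)

/-- A link diagram. -/
structure LinkDiagram extends PDCode where
  twoEnds : toPDCode.TwoEnds
  planar : toPDCode.Planar

/-! ## Links: diagrams up to Reidemeister moves -/

namespace PDCode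

/-- `D'` arises from `D` by removing the crossings in `R` and the arcs in `I` and by splicing
together the remaining arcs that are related by `r`. -/
def Splice (D D' : PDCode) (R : Set D.X) (I : Set D.A) (r : D.A → D.A → Prop) : Prop :=
  ∃ (f : D'.X ≃ {x : D.X // x ∉ R}) (q : {a : D.A // a ∉ I} → D'.A),
    Function.Surjective q ∧
    (∀ a b, q a = q b ↔
      Relation.EqvGen (fun a b : {a : D.A // a ∉ I} => r a.1 b.1) a b) ∧
    ∀ x i, ∃ h : D.arc (f x).1 i ∉ I, D'.arc x i = q ⟨D.arc (f x).1 i, h⟩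

/-- First Reidemeister move: a curl at the crossing `c` is removed. -/
def R1 (D D' : PDCode) : Prop :=
  ∃ (c : D.X) (i : Fin 4), D.arc c i = D.arc c (i + 1) ∧
    Splice D D' {c} {D.arc c i} (fun a b => a = D.arc c (i + 2) ∧ b = D.arc c (i + 3))

/-- Second Reidemeister move: a bigon between the crossings `c, c'`, one side of which is the
arc `x` of the under-strand `a - x - e` and the other side the arc `y` of the over-strand
`b - y - f`, is removed. -/
def R2 (D D' : PDCode) : Prop :=
  ∃ (c c' : D.X) (a x e b y f : D.A), c ≠ c' ∧
    D.arc c = ![a, y, x, b] ∧ D.arc c' = ![x, y, e, f] ∧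
    Splice D D' {c, c'} {x, y} (fun s t => (s = a ∧ t = e) ∨ (s = b ∧ t = f))

/-- Third Reidemeister move: three strands `b₁ b₂` (bottom), `m₁ m₂` (middle), `t₁ t₂` (top) cross
pairwise around a triangle with sides `u, v, w`, and the top strand is moved across the crossing
`c₁` of the other two. The two cases are reflections of each other in a vertical plane. -/
def R3 (D D' : PDCode) : Prop :=
  ∃ (g : D.X ≃ D'.X) (q : D.A ≃ D'.A) (c₁ c₂ c₃ : D.X) (b₁ b₂ m₁ m₂ t₁ t₂ u v w : D.A),
    c₁ ≠ c₂ ∧ c₁ ≠ c₃ ∧ c₂ ≠ c₃ ∧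
    (∀ x, x ≠ c₁ → x ≠ c₂ → x ≠ c₃ → ∀ i, D'.arc (g x) i = q (D.arc x i)) ∧
    ((D.arc c₁ = ![u, v, b₂, m₁] ∧ D.arc c₂ = ![b₁, w, u, t₁] ∧ D.arc c₃ = ![v, w, m₂, t₂] ∧
      D'.arc (g c₁) = q ∘ ![b₁, m₂, u, v] ∧ D'.arc (g c₂) = q ∘ ![u, t₂, b₂, w] ∧
      D'.arc (g c₃) = q ∘ ![m₁, t₁, v, w]) ∨
     (D.arc c₁ = ![u, m₁, b₂, v] ∧ D.arc c₂ = ![b₁, t₁, u, w] ∧ D.arc c₃ = ![v, t₂, m₂, w] ∧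
      D'.arc (g c₁) = q ∘ ![b₁, v, u, m₂] ∧ D'.arc (g c₂) = q ∘ ![u, w, b₂, t₂] ∧
      D'.arc (g c₃) = q ∘ ![m₁, w, v, t₁]))

end PDCode

/-- `D'` is isomorphic to `D` or arises from `D` by one Reidemeister move. -/
def LinkDiagram.Move (D D' : LinkDiagram) : Prop :=
  Nonempty (PDCode.Iso D.toPDCode D'.toPDCode) ∨ PDCode.R1 D.toPDCode D'.toPDCode ∨
    PDCode.R2 D.toPDCode D'.toPDCode ∨ PDCode.R3 D.toPDCode D'.toPDCode

/-- A link (unoriented, in the 3-sphere, up to isotopy): a class of link diagrams modulo the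
equivalence relation generated by the Reidemeister moves. -/
def Link : Type 1 := Quot LinkDiagram.Move

/-- The link of a diagram. -/
def LinkDiagram.link (D : LinkDiagram) : Link := Quot.mk _ D

/-! ## Twist equivalence and twist number -/

namespace PDCode

variable (D : PDCode)

/-- There is a circle in the plane of projection that meets the diagram only in the crossings `x`
and `y`: it passes through two opposite corners of `x` and two opposite corners of `y`, so it
exists when these corners lie in the same two faces. -/
def TwistEquiv (x y : D.X) : Prop :=
  ∃ i j, D.face x i = D.face y j ∧ D.face x (i + 2) = D.face y (j + 2)

/-- The twist number of a diagram: the number of classes of crossings up to twist equivalence. -/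
def twistNumber : ℕ := Nat.card (Quot D.TwistEquiv)

/-- The crossings `x ≠ y` are the two corners of a bigon (a face with two sides). -/
def Bigon (x y : D.X) : Prop :=
  x ≠ y ∧ ∃ i j, D.arc x (i + 1) = D.arc y j ∧ D.arc y (j + 1) = D.arc x i

/-- `x` and `y` are connected by a (possibly empty) chain of bigons. -/
def BigonConnected : D.X → D.X → Prop := Relation.EqvGen D.Bigon

/-- Any two twist equivalent crossings are connected by a chain of bigons. -/
def TwistReduced : Prop := ∀ x y, D.TwistEquiv x y → D.BigonConnected x y

end PDCode

/-- The twist number of a link: the minimum of the twist numbers of its diagrams. -/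
def Link.twistNumber (L : Link) : ℕ :=
  sInf {n | ∃ D : LinkDiagram, D.link = L ∧ D.twistNumber = n}

/-! # Coloured plane graphs and their link diagrams -/

/-- The two colours `c` and `s` of the edges. -/
inductive Colour
  | chain
  | sheaf
  deriving DecidableEq

/-- A finite plane multigraph with vertex set `V` and ordered edges `0, …, k - 1`, each with a
colour. The edge `i` has the two darts `(i, false)` and `(i, true)`, at its two ends. The embedding
is given by the permutation `rot`, which sends a dart to the next one counterclockwise around the
same vertex; the last field is Euler's formula. -/
structure ColouredPlaneGraph (k : ℕ) (V : Type) [Fintype V] where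
  colour : Fin k → Colour
  vert : Fin k × Bool → V
  rot : Equiv.Perm (Fin k × Bool)
  sameCycle_iff : ∀ a b, rot.SameCycle a b ↔ vert a = vert b
  /-- `#V - #E + #F = 2 #components`, where the orbits of "go to the other end of the edge, then to
  the next dart" are the faces, an isolated vertex lying in one more face that has no darts. -/
  euler :
    Fintype.card V +
      (Nat.card (Quotient (Equiv.Perm.SameCycle.setoid
        (rot * (Equiv.prodCongr (Equiv.refl (Fin k)) Equiv.boolNot)))) +
        Nat.card {v : V // ∀ a, vert a ≠ v}) =
    k + 2 * Nat.card (Quot fun u v : V => ∃ i, vert (i, false) = u ∧ vert (i, true) = v)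

namespace ColouredPlaneGraph

variable {k : ℕ} {V : Type} [Fintype V] (G : ColouredPlaneGraph k V)

/-- `u` and `v` are connected by edges in `S`. -/
def Reachable (S : Finset (Fin k)) : V → V → Prop :=
  Relation.EqvGen fun u v => ∃ i ∈ S, G.vert (i, false) = u ∧ G.vert (i, true) = v

/-- The spanning subgraph with edge set `S` is connected. -/
def ConnectedOn (S : Finset (Fin k)) : Prop := Nonempty V ∧ ∀ u v, G.Reachable S u v

/-- The graph is connected. -/
def Connected : Prop := G.ConnectedOn Finset.univ

/-- The spanning subgraph with edge set `F` is a tree: it is connected and has no cycle (no edge of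
`F` joins two vertices which the other edges of `F` already connect). -/
def IsSpanningTree (F : Finset (Fin k)) : Prop :=
  G.ConnectedOn F ∧ ∀ i ∈ F, ¬ G.Reachable (F.erase i) (G.vert (i, false)) (G.vert (i, true))

/-- `p_F`, the number of sheaves in `F` plus the number of chains not in `F`. -/
def treeWeight (F : Finset (Fin k)) : ℕ :=
  (F.filter fun i => G.colour i = .sheaf).card + (Fᶜ.filter fun i => G.colour i = .chain).card

open Classical in
/-- `p`, the maximum of `p_F` over all spanning trees `F`. -/
def maxTreeWeight : ℕ := (Finset.univ.filter G.IsSpanningTree).sup G.treeWeight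

/-! ## The diagram `D_t`

The edge `i` is replaced by a chain (`|t i|` edges in series) or a sheaf (`|t i|` parallel edges)
of edges of sign `sign (t i)`, and each of these becomes a crossing. Draw the edge horizontally
with the dart `(i, false)` at its left end, and list the four corners around it as
`0 = NE, 1 = NW, 2 = SW, 3 = SE`. The crossings of a chain form a row from left to right, those of a
sheaf a column from bottom to top. The arcs of this twist region are `(j, b)` with `0 ≤ j ≤ |t i|`:
the two arcs between the crossings number `j - 1` and `j`. For a chain, `b` tells the upper arc
(`true`) from the lower one, for a sheaf the right arc (`true`) from the left one. If `t i = 0`, a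
chain leaves an upper and a lower arc (the edge is contracted), a sheaf a left and a right arc (the
edge is deleted). -/

/-- The arcs at the four corners of the part of a twist region that starts at level `j` and ends at
level `j'`. -/
def cornerArc {n : ℕ} : Colour → Fin (n + 1) → Fin (n + 1) → Fin 4 → Fin (n + 1) × Bool
  | .chain, j, j' => ![(j', true), (j, true), (j, false), (j', false)]
  | .sheaf, j, j' => ![(j', true), (j', false), (j, false), (j, true)]

/-- The arcs of `D_t` before the twist regions are connected to each other. An isolated vertex of
the graph contributes a simple closed curve. -/
def PreArc (t : Fin k → ℤ) : Type :=
  (Σ i : Fin k, Fin ((t i).natAbs + 1) × Bool) ⊕ {v : V // ∀ a, G.vert a ≠ v}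

instance (t : Fin k → ℤ) : Finite (G.PreArc t) :=
  inferInstanceAs (Finite ((Σ i : Fin k, Fin ((t i).natAbs + 1) × Bool) ⊕ _))

/-- The arc of the twist region `i` that leaves it at the corner `c`. -/
def outerArc (t : Fin k → ℤ) (i : Fin k) (c : Fin 4) : G.PreArc t :=
  .inl ⟨i, cornerArc (G.colour i) 0 (Fin.last _) c⟩

/-- The arc leaving the twist region of a dart on the left side of the dart, seen from its vertex
(NW for `(i, false)`, SE for `(i, true)`). -/
def leftArc (t : Fin k → ℤ) (a : Fin k × Bool) : G.PreArc t :=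
  G.outerArc t a.1 (if a.2 then 3 else 1)

/-- The arc leaving the twist region of a dart on the right side of the dart, seen from its vertex
(SW for `(i, false)`, NE for `(i, true)`). -/
def rightArc (t : Fin k → ℤ) (a : Fin k × Bool) : G.PreArc t :=
  G.outerArc t a.1 (if a.2 then 0 else 2)

/-- Twist regions that follow each other around a vertex are connected along its boundary. -/
def Glue (t : Fin k → ℤ) (a b : G.PreArc t) : Prop :=
  ∃ h, a = G.leftArc t h ∧ b = G.rightArc t (G.rot h)

/-- The link diagram `D_t` of the coloured plane graph `G` and `t ∈ ℤ ^ k`. At a crossing of a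
positive (negative) edge, the positive smoothing joins (separates) the regions that correspond to
the two vertices of the edge. -/
def diagram (t : Fin k → ℤ) : PDCode where
  X := Σ i : Fin k, Fin (t i).natAbs
  A := Quot (G.Glue t)
  arc x c := Quot.mk _ (.inl ⟨x.1, cornerArc (G.colour x.1) x.2.castSucc x.2.succ
    (if 0 < t x.1 then c else c + 1)⟩)
  finiteA := Quot.finite _

/-- `G`, with the twist parameters `t`, is the template of the diagram `D`: `D` is `D_t`, no twist
parameter vanishes, and the edges of `G` are the full chains and sheaves of `D`, i.e. crossings
come from the same edge of `G` if and only if they are connected by a chain of bigons. -/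
def IsTemplate (t : Fin k → ℤ) (D : LinkDiagram) : Prop :=
  Nonempty (PDCode.Iso D.toPDCode (G.diagram t)) ∧ (∀ i, t i ≠ 0) ∧
    ∀ x y : (G.diagram t).X, (G.diagram t).BigonConnected x y ↔ x.1 = y.1

/-- The twist parameters in the convention of wiring diagrams: `r i = t i` for a chain and
`r i = - t i` for a sheaf. -/
def signedTwist (t : Fin k → ℤ) (i : Fin k) : ℤ :=
  match G.colour i with
  | .chain => t i
  | .sheaf => - t i

end ColouredPlaneGraph

/-- `(-A⁻⁴) ^ n` for `n ∈ ℤ`. -/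
def twistPower (n : ℤ) : ℤ[T;T⁻¹] :=
  LaurentPolynomial.C (n.negOnePow : ℤ) * LaurentPolynomial.T (-4 * n)

end TwistBracket

end

/-!
The bracket of `D_t` is a sum over the smoothings of all crossings. In the twist region of an edge
`i`, one of the two smoothings joins the arcs lengthwise, and the other one cuts the region across.
A region without cuts acts like one smoothing of a single crossing, and a region with `m ≥ 1` cuts
acts like the other smoothing and encloses `m - 1` circles (`circles_cutState`). A chain that is not
cut is contracted in the template graph `G`, and one that is cut is deleted; for a sheaf it is the
other way round. With `r = r_i` and `x = (-A⁻⁴) ^ r`, the states with a cut contribute, by the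
binomial theorem, `A ^ r * (x - 1) / d` (`d_mul_cutSum`), and the state without a cut `A ^ r`. Hence
`⟨D_t⟩` is `A ^ (∑ r_i)` times the sum over the sets `W` of cut edges of

`d ^ (c - 1) * ∏ i ∈ W, (x_i - 1) / d`,

where `c` is the number of boundary circles of a neighbourhood of the contracted subgraph `S`.

It remains to see that `d ^ p` clears the denominators, that is `#W ≤ p + c - 1`
(`treeWeight_add_one_le`). Here `#W` is the tree weight `p_S`, extended to all subgraphs, which
changes by at most one when an edge is added or removed; so it is enough to reach a spanning tree
from `S` in at most `c - 1` such steps. The boundary circles are the cycles of the permutation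
`rot * flipOn S`, and adding an edge composes it with a transposition. While `S` is disconnected, add
an edge between two components: it merges two boundary circles into one. If `S` is connected, Euler's
formula for `G` gives `c ≥ #S - #V + 2`, so removing the surplus edges over a spanning tree takes at
most `c - 1` steps.

The bound on `p` is elementary: `p ≤ k`, and in a twist-reduced diagram the crossings of the `k`
edges of a template graph lie in different twist classes.
-/

namespace TwistBracket

/-! ### Counting classes of relations and cycles of permutations -/

section Counting

variable {α : Type*}

theorem card_quot_le_card_quot_join_add_one [Finite α] (r : α → α → Prop) (a b : α) :
    Nat.card (Quot r) ≤ Nat.card (Quot fun x y => r x y ∨ (x = a ∧ y = b)) + 1 := by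
  classical
  let g : (Quot fun x y => r x y ∨ (x = a ∧ y = b)) → Quot r :=
    Quot.lift (fun z => if Quot.mk r z = Quot.mk r b then Quot.mk r a else Quot.mk r z) (by
      rintro x y (h | ⟨rfl, rfl⟩)
      · simp only [Quot.sound h]
      · simp)
  rw [← Finite.card_option]
  refine Nat.card_le_card_of_surjective (fun o => o.elim (Quot.mk r b) g) ?_
  rintro ⟨x⟩
  by_cases hx : Quot.mk r x = Quot.mk r b
  · exact ⟨none, hx.symm⟩
  · exact ⟨some (Quot.mk _ x), if_neg hx⟩

theorem card_quot_join_add_one_le [Finite α] (r : α → α → Prop) {a b : α}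
    (h : Quot.mk r a ≠ Quot.mk r b) :
    Nat.card (Quot fun x y => r x y ∨ (x = a ∧ y = b)) + 1 ≤ Nat.card (Quot r) := by
  classical
  let f : Quot r → (Quot fun x y => r x y ∨ (x = a ∧ y = b)) :=
    Quot.map id fun _ _ hxy => Or.inl hxy
  have hf : Function.Surjective f := by
    rintro ⟨x⟩
    exact ⟨Quot.mk _ x, rfl⟩
  by_contra! hlt
  have hcard : Nat.card (Quot r) = Nat.card (Quot fun x y => r x y ∨ (x = a ∧ y = b)) :=
    le_antisymm (by omega) (Nat.card_le_card_of_surjective f hf)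
  have hbij := (Nat.bijective_iff_surjective_and_card f).2 ⟨hf, hcard⟩
  exact h (hbij.1 (Quot.sound (Or.inr ⟨rfl, rfl⟩)))

open Equiv Equiv.Perm

theorem SameCycle.apply_eq {β : Type*} {σ : Perm α} {f : α → β}
    (hf : ∀ x, f (σ x) = f x) {x y : α} (h : σ.SameCycle x y) : f x = f y := by
  obtain ⟨n, rfl⟩ := h
  induction n with
  | zero => simp
  | succ n ih => rw [add_comm, zpow_add, zpow_one, mul_apply, hf, ih]
  | pred n ih =>
    rw [ih, ← hf ((σ ^ (-(n : ℤ) - 1)) x), ← mul_apply, ← zpow_one_add]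
    congr 3
    ring

/-- The number of cycles of a permutation, fixed points included. -/
noncomputable def numCycles (σ : Perm α) : ℕ := Nat.card (Quotient (SameCycle.setoid σ))

theorem card_join_sameCycle_mul_swap_le [Finite α] [DecidableEq α] (σ : Perm α) (a b : α) :
    Nat.card (Quot fun x y => (σ * swap a b).SameCycle x y ∨ (x = a ∧ y = b)) ≤
      Nat.card (Quot fun x y => σ.SameCycle x y ∨ (x = a ∧ y = b)) := by
  set r' : α → α → Prop := fun x y => (σ * swap a b).SameCycle x y ∨ (x = a ∧ y = b)
  have hab : Quot.mk r' a = Quot.mk r' b := Quot.sound (Or.inr ⟨rfl, rfl⟩)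
  have hσ' : ∀ x, Quot.mk r' ((σ * swap a b) x) = Quot.mk r' x := fun x =>
    Quot.sound (Or.inl (sameCycle_apply_left.2 (SameCycle.refl _ _)))
  have hσ : ∀ x, Quot.mk r' (σ x) = Quot.mk r' x := by
    intro x
    by_cases hxa : x = a
    · subst hxa
      rw [hab, ← hσ' b, mul_apply, swap_apply_right]
    by_cases hxb : x = b
    · subst hxb
      rw [← hab, ← hσ' a, mul_apply, swap_apply_left]
    · rw [← hσ' x, mul_apply, swap_apply_of_ne_of_ne hxa hxb]
  refine Nat.card_le_card_of_surjective (Quot.lift (Quot.mk r') ?_) ?_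
  · rintro x y (h | ⟨rfl, rfl⟩)
    · exact SameCycle.apply_eq hσ h
    · exact hab
  · rintro ⟨x⟩
    exact ⟨Quot.mk _ x, rfl⟩

theorem numCycles_mul_swap_le [Finite α] [DecidableEq α] (σ : Perm α) (a b : α) :
    numCycles (σ * swap a b) ≤ numCycles σ + 1 := by
  refine (card_quot_le_card_quot_join_add_one (σ * swap a b).SameCycle a b).trans ?_
  refine Nat.add_le_add_right ((card_join_sameCycle_mul_swap_le σ a b).trans ?_) 1
  refine Nat.card_le_card_of_surjective
    (Quot.map id fun _ _ h => Or.inl h : Quot σ.SameCycle → _) ?_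
  rintro ⟨x⟩
  exact ⟨Quot.mk _ x, rfl⟩

/-- Composing with a transposition of elements of different cycles joins them. -/
theorem sameCycle_mul_swap [Finite α] [DecidableEq α] {σ : Perm α} {a b : α}
    (h : ¬ σ.SameCycle a b) : (σ * swap a b).SameCycle a b := by
  obtain ⟨n, hn, hnb⟩ := (SameCycle.refl σ b).exists_pow_eq''
  -- The cycle of `a` now follows the old cycle of `b`, from `σ b` on, until it reaches `b`.
  have key : ∀ m, (σ * swap a b).SameCycle a ((σ ^ (m + 1)) b) := by
    intro m
    induction m with
    | zero =>
      refine ⟨1, ?_⟩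
      simp
    | succ m ih =>
      by_cases hb : (σ ^ (m + 1)) b = b
      · rw [pow_succ', mul_apply, hb]
        exact ⟨1, by simp⟩
      · have ha : (σ ^ (m + 1)) b ≠ a := by
          intro ha
          exact h (SameCycle.symm ⟨(m + 1 : ℕ), by rw [zpow_natCast]; exact ha⟩)
        have : (σ ^ (m + 1 + 1)) b = (σ * swap a b) ((σ ^ (m + 1)) b) := by
          rw [mul_apply, swap_apply_of_ne_of_ne ha hb, pow_succ' σ (m + 1), mul_apply]
        rw [this]
        exact sameCycle_apply_right.2 ih
  have := key (n - 1)
  rwa [Nat.sub_add_cancel hn, hnb.2] at this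

/-- Composing with a transposition merges two different cycles. -/
theorem numCycles_mul_swap_add_one_le [Finite α] [DecidableEq α] {σ : Perm α} {a b : α}
    (h : ¬ σ.SameCycle a b) : numCycles (σ * swap a b) + 1 ≤ numCycles σ := by
  have hne : Quot.mk σ.SameCycle a ≠ Quot.mk σ.SameCycle b := fun hab =>
    h (Quotient.exact (s := SameCycle.setoid σ) hab)
  refine le_trans (Nat.add_le_add_right ?_ 1) (card_quot_join_add_one_le σ.SameCycle hne)
  refine le_trans ?_ (card_join_sameCycle_mul_swap_le σ a b)
  refine Nat.card_le_card_of_surjective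
    (Quot.lift (Quotient.mk (SameCycle.setoid (σ * swap a b))) ?_) ?_
  · rintro x y (hxy | ⟨rfl, rfl⟩)
    · exact Quotient.sound hxy
    · exact Quotient.sound (sameCycle_mul_swap h)
  · rintro ⟨x⟩
    exact ⟨Quot.mk _ x, rfl⟩

end Counting

/-! ### Boundary circles of ribbon subgraphs -/

namespace ColouredPlaneGraph

open Equiv Equiv.Perm

variable {k : ℕ} {V : Type} [Fintype V] (G : ColouredPlaneGraph k V)

/-- Exchanges the two darts of each edge in `S`. -/
def flipOn (S : Finset (Fin k)) : Perm (Fin k × Bool) :=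
  Function.Involutive.toPerm (fun h => if h.1 ∈ S then (h.1, !h.2) else h) fun h => by
    by_cases hS : h.1 ∈ S <;> simp [hS]

theorem flipOn_apply (S : Finset (Fin k)) (h : Fin k × Bool) :
    flipOn S h = if h.1 ∈ S then (h.1, !h.2) else h := rfl

theorem flipOn_flipOn (S : Finset (Fin k)) (h : Fin k × Bool) : flipOn S (flipOn S h) = h := by
  by_cases hS : h.1 ∈ S <;> simp [flipOn_apply, hS]

theorem flipOn_insert {S : Finset (Fin k)} {e : Fin k} (he : e ∉ S) :
    flipOn (insert e S) = flipOn S * swap (e, false) (e, true) := by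
  ext1 ⟨i, b⟩
  by_cases hi : i = e
  · subst hi
    cases b <;> simp [flipOn_apply, he]
  · rw [mul_apply, swap_apply_of_ne_of_ne (by simp [hi]) (by simp [hi])]
    simp [flipOn_apply, hi]

/-- Walks along the boundary of a neighbourhood of the spanning subgraph with edge set `S`. The
darts of edges outside `S` are passed on the way around their vertex. -/
def boundaryPerm (S : Finset (Fin k)) : Perm (Fin k × Bool) := G.rot * flipOn S

theorem boundaryPerm_insert {S : Finset (Fin k)} {e : Fin k} (he : e ∉ S) :
    G.boundaryPerm (insert e S) = G.boundaryPerm S * swap (e, false) (e, true) := by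
  rw [boundaryPerm, flipOn_insert he, ← mul_assoc, boundaryPerm]

/-- The number of boundary circles of a neighbourhood of the spanning subgraph with edge set
`S`. -/
noncomputable def numBoundary (S : Finset (Fin k)) : ℕ :=
  numCycles (G.boundaryPerm S) + Nat.card {v : V // ∀ a, G.vert a ≠ v}

theorem numBoundary_insert_le (S : Finset (Fin k)) (e : Fin k) :
    G.numBoundary (insert e S) ≤ G.numBoundary S + 1 := by
  by_cases he : e ∈ S
  · simp [Finset.insert_eq_of_mem he]
  · have := numCycles_mul_swap_le (G.boundaryPerm S) (e, false) (e, true)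
    rw [numBoundary, numBoundary, boundaryPerm_insert G he]
    omega

theorem numBoundary_pos [Nonempty V] (S : Finset (Fin k)) : 0 < G.numBoundary S := by
  obtain ⟨v⟩ := ‹Nonempty V›
  by_cases hv : ∀ a, G.vert a ≠ v
  · have : Nonempty {v : V // ∀ a, G.vert a ≠ v} := ⟨⟨v, hv⟩⟩
    exact Nat.add_pos_right _ Nat.card_pos
  · push Not at hv
    obtain ⟨a, -⟩ := hv
    have : Nonempty (Quotient (SameCycle.setoid (G.boundaryPerm S))) := ⟨Quotient.mk _ a⟩
    exact Nat.add_pos_left Nat.card_pos _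

theorem reachable_of_sameCycle {S : Finset (Fin k)} {a b : Fin k × Bool}
    (h : (G.boundaryPerm S).SameCycle a b) : G.Reachable S (G.vert a) (G.vert b) := by
  let f : Fin k × Bool → Quot fun u v => ∃ i ∈ S, G.vert (i, false) = u ∧ G.vert (i, true) = v :=
    fun a => Quot.mk _ (G.vert a)
  refine Quot.eqvGen_exact (SameCycle.apply_eq (f := f) (fun x => ?_) h)
  have hrot : G.vert (G.boundaryPerm S x) = G.vert (flipOn S x) :=
    (G.sameCycle_iff _ _).1 (sameCycle_apply_left.2 (SameCycle.refl _ _))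
  change Quot.mk _ (G.vert _) = Quot.mk _ (G.vert x)
  rw [hrot, flipOn_apply]
  split_ifs with hS
  · obtain ⟨i, b⟩ := x
    cases b
    · exact (Quot.sound ⟨i, hS, rfl, rfl⟩).symm
    · exact Quot.sound ⟨i, hS, rfl, rfl⟩
  · rfl

/-- An edge that joins two components of a subgraph joins two boundary circles into one. -/
theorem numBoundary_insert_add_one_le {S : Finset (Fin k)} {e : Fin k}
    (he : ¬ G.Reachable S (G.vert (e, false)) (G.vert (e, true))) :
    G.numBoundary (insert e S) + 1 ≤ G.numBoundary S := by
  have heS : e ∉ S := fun h => he (Relation.EqvGen.rel _ _ ⟨e, h, rfl, rfl⟩)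
  have := numCycles_mul_swap_add_one_le fun h => he (G.reachable_of_sameCycle h)
  rw [numBoundary, numBoundary, boundaryPerm_insert G heS]
  omega

/-- Euler's formula for a connected graph. -/
theorem numBoundary_univ_add_card (hG : G.Connected) :
    G.numBoundary Finset.univ + Fintype.card V = k + 2 := by
  have hflip : flipOn (Finset.univ : Finset (Fin k)) =
      Equiv.prodCongr (Equiv.refl (Fin k)) Equiv.boolNot := by
    ext1 ⟨i, b⟩
    simp [flipOn_apply]
  have hone : Nat.card (Quot fun u v : V => ∃ i, G.vert (i, false) = u ∧ G.vert (i, true) = v)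
      = 1 := by
    rw [Nat.card_eq_one_iff_unique]
    refine ⟨⟨?_⟩, hG.1.map (Quot.mk _)⟩
    rintro ⟨u⟩ ⟨v⟩
    refine Quot.eqvGen_sound (Relation.EqvGen.mono ?_ u v (hG.2 u v))
    rintro _ _ ⟨i, -, h⟩
    exact ⟨i, h⟩
  have := G.euler
  rw [hone] at this
  rw [numBoundary, boundaryPerm, numCycles, hflip]
  omega

/-- Deleting the edges outside `S` one by one lowers the number of boundary circles by at most one
each time, so Euler's formula for the whole graph leaves an inequality for `S`. -/
theorem le_numBoundary_add (hG : G.Connected) (S : Finset (Fin k)) :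
    S.card + 2 ≤ G.numBoundary S + Fintype.card V := by
  have key : ∀ T : Finset (Fin k), G.numBoundary (S ∪ T) ≤ G.numBoundary S + T.card := by
    intro T
    induction T using Finset.induction_on with
    | empty => simp
    | insert e T he ih =>
      rw [Finset.union_insert, Finset.card_insert_of_notMem he]
      have := G.numBoundary_insert_le (S ∪ T) e
      omega
  have h1 := key Sᶜ
  rw [Finset.union_compl, Finset.card_compl, Fintype.card_fin] at h1
  have h2 := G.numBoundary_univ_add_card hG
  have h3 := S.card_le_univ
  rw [Fintype.card_fin] at h3
  omega

/-- A spanning subgraph with edge set `F` has at least `#V - #F` components. -/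
theorem card_vert_le (F : Finset (Fin k)) :
    Fintype.card V ≤
      Nat.card (Quot fun u v => ∃ i ∈ F, G.vert (i, false) = u ∧ G.vert (i, true) = v) +
        F.card := by
  induction F using Finset.induction_on with
  | empty =>
    rw [← Nat.card_eq_fintype_card, Finset.card_empty, add_zero]
    exact Nat.card_le_card_of_injective (Quot.mk _) (Function.LeftInverse.injective
      (g := Quot.lift id fun u v h => absurd h (by simp)) fun _ => rfl)
  | insert e F he ih =>
    rw [Finset.card_insert_of_notMem he]
    have h1 := card_quot_le_card_quot_join_add_one
      (fun u v => ∃ i ∈ F, G.vert (i, false) = u ∧ G.vert (i, true) = v)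
      (G.vert (e, false)) (G.vert (e, true))
    have h2 : Nat.card (Quot fun u v => (∃ i ∈ F, G.vert (i, false) = u ∧ G.vert (i, true) = v) ∨
          (u = G.vert (e, false) ∧ v = G.vert (e, true))) ≤
        Nat.card (Quot fun u v => ∃ i ∈ insert e F,
          G.vert (i, false) = u ∧ G.vert (i, true) = v) := by
      refine Nat.card_le_card_of_surjective (Quot.map id ?_) ?_
      · rintro u v ⟨i, hi, rfl, rfl⟩
        rcases Finset.mem_insert.1 hi with rfl | hi
        · exact Or.inr ⟨rfl, rfl⟩
        · exact Or.inl ⟨i, hi, rfl, rfl⟩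
      · rintro ⟨u⟩
        exact ⟨Quot.mk _ u, rfl⟩
    omega

theorem ConnectedOn.card_vert_le {G : ColouredPlaneGraph k V} {F : Finset (Fin k)}
    (hF : G.ConnectedOn F) : Fintype.card V ≤ F.card + 1 := by
  have h := G.card_vert_le F
  have hone : Nat.card (Quot fun u v => ∃ i ∈ F, G.vert (i, false) = u ∧ G.vert (i, true) = v)
      = 1 := by
    rw [Nat.card_eq_one_iff_unique]
    refine ⟨⟨?_⟩, hF.1.map (Quot.mk _)⟩
    rintro ⟨u⟩ ⟨v⟩
    exact Quot.eqvGen_sound (hF.2 u v)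
  omega

theorem ConnectedOn.exists_isSpanningTree {G : ColouredPlaneGraph k V} {S : Finset (Fin k)}
    (hS : G.ConnectedOn S) : ∃ F ⊆ S, G.IsSpanningTree F := by
  induction S using Finset.strongInduction with
  | H S ih =>
    by_cases hT : ∀ i ∈ S, ¬ G.Reachable (S.erase i) (G.vert (i, false)) (G.vert (i, true))
    · exact ⟨S, subset_rfl, hS, hT⟩
    · push Not at hT
      obtain ⟨e, he, hr⟩ := hT
      have hconn : G.ConnectedOn (S.erase e) := by
        refine ⟨hS.1, fun u v => ?_⟩
        have h := hS.2 u v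
        induction h with
        | rel u v h =>
          obtain ⟨i, hi, rfl, rfl⟩ := h
          by_cases hie : i = e
          · rwa [hie]
          · exact Relation.EqvGen.rel _ _ ⟨i, Finset.mem_erase.2 ⟨hie, hi⟩, rfl, rfl⟩
        | refl => exact Relation.EqvGen.refl _
        | symm _ _ _ h => exact Relation.EqvGen.symm _ _ h
        | trans _ _ _ _ _ h1 h2 => exact Relation.EqvGen.trans _ _ _ h1 h2
      obtain ⟨F, hF, hF'⟩ := ih _ (Finset.erase_ssubset he) hconn
      exact ⟨F, hF.trans (Finset.erase_subset _ _), hF'⟩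

/-! ### Tree weights -/

theorem treeWeight_le_insert_add_one (S : Finset (Fin k)) (e : Fin k) :
    G.treeWeight S ≤ G.treeWeight (insert e S) + 1 := by
  have h1 : (S.filter fun i => G.colour i = .sheaf).card ≤
      ((insert e S).filter fun i => G.colour i = .sheaf).card :=
    Finset.card_le_card (Finset.filter_subset_filter _ (Finset.subset_insert _ _))
  have h2 : (Sᶜ.filter fun i => G.colour i = .chain) ⊆
      insert e ((insert e S)ᶜ.filter fun i => G.colour i = .chain) := by
    intro i
    simp only [Finset.mem_filter, Finset.mem_compl, Finset.mem_insert]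
    tauto
  have h3 := (Finset.card_le_card h2).trans (Finset.card_insert_le _ _)
  unfold treeWeight
  omega

theorem treeWeight_le_add_card_sdiff {F S : Finset (Fin k)} (h : F ⊆ S) :
    G.treeWeight S ≤ G.treeWeight F + (S.card - F.card) := by
  have h1 : (S.filter fun i => G.colour i = .sheaf) ⊆
      (F.filter fun i => G.colour i = .sheaf) ∪ (S \ F) := by
    intro i
    simp only [Finset.mem_filter, Finset.mem_union, Finset.mem_sdiff]
    tauto
  have h2 : (Sᶜ.filter fun i => G.colour i = .chain).card ≤
      (Fᶜ.filter fun i => G.colour i = .chain).card :=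
    Finset.card_le_card (Finset.filter_subset_filter _ (Finset.compl_subset_compl.2 h))
  have h3 := (Finset.card_le_card h1).trans (Finset.card_union_le _ _)
  rw [Finset.card_sdiff_of_subset h] at h3
  unfold treeWeight
  omega

theorem treeWeight_le_card (S : Finset (Fin k)) : G.treeWeight S ≤ k := by
  have h1 := Finset.card_filter_le S fun i => G.colour i = .sheaf
  have h2 := Finset.card_filter_le Sᶜ fun i => G.colour i = .chain
  have h3 := S.card_add_card_compl
  rw [Fintype.card_fin] at h3
  unfold treeWeight
  omega

theorem maxTreeWeight_le : G.maxTreeWeight ≤ k :=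
  Finset.sup_le fun S _ => G.treeWeight_le_card S

theorem IsSpanningTree.treeWeight_le {G : ColouredPlaneGraph k V} {F : Finset (Fin k)}
    (hF : G.IsSpanningTree F) : G.treeWeight F ≤ G.maxTreeWeight := by
  classical
  exact Finset.le_sup (f := G.treeWeight) (Finset.mem_filter.2 ⟨Finset.mem_univ _, hF⟩)

/-- The powers of `d` in the denominator of the contribution of the subgraph `S` are compensated by
the factor `d ^ G.maxTreeWeight` and by the circles of `S`: in the plane, `S` differs from a
spanning tree by at most as many edges as it has boundary circles beyond the first. -/
theorem treeWeight_add_one_le (hG : G.Connected) (S : Finset (Fin k)) :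
    G.treeWeight S + 1 ≤ G.maxTreeWeight + G.numBoundary S := by
  induction hn : Sᶜ.card using Nat.strong_induction_on generalizing S with
  | _ n ih =>
    by_cases hS : G.ConnectedOn S
    · obtain ⟨F, hFS, hF⟩ := hS.exists_isSpanningTree
      have h1 := G.treeWeight_le_add_card_sdiff hFS
      have h2 := hF.treeWeight_le
      have h3 := hF.1.card_vert_le
      have h4 := G.le_numBoundary_add hG S
      have h5 := Finset.card_le_card hFS
      omega
    · obtain ⟨e, he⟩ : ∃ e, ¬ G.Reachable S (G.vert (e, false)) (G.vert (e, true)) := by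
        by_contra! hcon
        refine hS ⟨hG.1, fun u v => ?_⟩
        have h := hG.2 u v
        induction h with
        | rel u v h =>
          obtain ⟨i, -, rfl, rfl⟩ := h
          exact hcon i
        | refl => exact Relation.EqvGen.refl _
        | symm _ _ _ h => exact Relation.EqvGen.symm _ _ h
        | trans _ _ _ _ _ h1 h2 => exact Relation.EqvGen.trans _ _ _ h1 h2
      have heS : e ∉ S := fun h => he (Relation.EqvGen.rel _ _ ⟨e, h, rfl, rfl⟩)
      have hlt : (insert e S)ᶜ.card < n := by
        rw [← hn]
        refine Finset.card_lt_card (Finset.compl_ssubset_compl.2 ?_)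
        exact Finset.ssubset_insert heS
      have h1 := ih _ hlt (insert e S) rfl
      have h2 := G.treeWeight_le_insert_add_one S e
      have h3 := G.numBoundary_insert_add_one_le he
      omega

end ColouredPlaneGraph

/-! ### Twist numbers -/

namespace PDCode

theorem Iso.bigon {D D' : PDCode} (φ : Iso D D') {x y : D.X} (h : D.Bigon x y) :
    D'.Bigon (φ.crossings x) (φ.crossings y) := by
  obtain ⟨hne, i, j, h1, h2⟩ := h
  refine ⟨fun h => hne (φ.crossings.injective h),
    i + if φ.turn x then 2 else 0, j + if φ.turn y then 2 else 0, ?_, ?_⟩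
  · rw [← φ.arc_eq, add_right_comm, ← φ.arc_eq, h1]
  · rw [← φ.arc_eq, add_right_comm, ← φ.arc_eq, h2]

theorem Iso.bigonConnected {D D' : PDCode} (φ : Iso D D') {x y : D.X}
    (h : D.BigonConnected x y) : D'.BigonConnected (φ.crossings x) (φ.crossings y) := by
  induction h with
  | rel _ _ h => exact Relation.EqvGen.rel _ _ (φ.bigon h)
  | refl => exact Relation.EqvGen.refl _
  | symm _ _ _ h => exact Relation.EqvGen.symm _ _ h
  | trans _ _ _ _ _ h1 h2 => exact Relation.EqvGen.trans _ _ _ h1 h2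

end PDCode

/-- In a twist-reduced diagram the crossings of different edges of a template lie in different twist
classes. -/
theorem ColouredPlaneGraph.IsTemplate.le_twistNumber {k : ℕ} {V : Type} [Fintype V]
    {G : ColouredPlaneGraph k V} {t : Fin k → ℤ} {D : LinkDiagram} (h : G.IsTemplate t D)
    (hred : D.TwistReduced) : k ≤ D.twistNumber := by
  obtain ⟨⟨φ⟩, ht, hconn⟩ := h
  have : Finite (Quot D.TwistEquiv) := Quot.finite _
  rw [← Nat.card_fin k]
  refine Nat.card_le_card_of_surjective
    (Quot.lift (fun x => (φ.crossings x).1) fun x y hxy =>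
      (hconn _ _).1 (φ.bigonConnected (hred x y hxy))) fun i => ?_
  let x : (G.diagram t).X := ⟨i, ⟨0, Int.natAbs_pos.2 (ht i)⟩⟩
  exact ⟨Quot.mk _ (φ.crossings.symm x), congrArg Sigma.fst (φ.crossings.apply_symm_apply x)⟩

/-! ### The circles of a state of `D_t` -/

theorem PDCode.joined_imp_eq_iff (D : PDCode) (S : Finset D.X) {β : Type*} (f : D.A → β) :
    (∀ a b, D.Joined S a b → f a = f b) ↔ ∀ x,
      (x ∈ S → f (D.arc x 0) = f (D.arc x 1) ∧ f (D.arc x 2) = f (D.arc x 3)) ∧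
      (x ∉ S → f (D.arc x 1) = f (D.arc x 2) ∧ f (D.arc x 3) = f (D.arc x 0)) := by
  constructor
  · intro h x
    exact ⟨fun hx => ⟨h _ _ (Or.inl ⟨x, hx, Or.inl ⟨rfl, rfl⟩⟩),
        h _ _ (Or.inl ⟨x, hx, Or.inr ⟨rfl, rfl⟩⟩)⟩,
      fun hx => ⟨h _ _ (Or.inr ⟨x, hx, Or.inl ⟨rfl, rfl⟩⟩),
        h _ _ (Or.inr ⟨x, hx, Or.inr ⟨rfl, rfl⟩⟩)⟩⟩
  · rintro h a b (⟨x, hx, ⟨rfl, rfl⟩ | ⟨rfl, rfl⟩⟩ | ⟨x, hx, ⟨rfl, rfl⟩ | ⟨rfl, rfl⟩⟩)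
    exacts [((h x).1 hx).1, ((h x).1 hx).2, ((h x).2 hx).1, ((h x).2 hx).2]

namespace ColouredPlaneGraph

open Equiv Equiv.Perm

variable {k : ℕ} {V : Type} [Fintype V] (G : ColouredPlaneGraph k V)

/-- The state of `D_t` in which the set of crossings of the edge `i` whose smoothing cuts the twist
region across is `M i`: the smoothing separates the two vertices of a chain and joins those of a
sheaf. The other smoothings join the two arcs on each side of the twist region lengthwise. -/
def cutState (t : Fin k → ℤ) (M : ∀ i, Finset (Fin (t i).natAbs)) : Finset (G.diagram t).X :=
  Finset.univ.sigma fun i => if G.signedTwist t i < 0 then M i else (M i)ᶜ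

/-- The edges that are contracted in a state in which exactly the twist regions of the edges in `W`
are cut across: the chains outside `W` and the sheaves in `W`. -/
def contracted (W : Finset (Fin k)) : Finset (Fin k) :=
  Finset.univ.filter fun i => (G.colour i = .sheaf ↔ i ∈ W)

/-- So the tree weight of a subgraph counts the twist regions that are cut across. -/
theorem treeWeight_contracted (W : Finset (Fin k)) : G.treeWeight (G.contracted W) = W.card := by
  rw [treeWeight, ← Finset.card_union_of_disjoint]
  · congr 1
    ext i
    rcases hc : G.colour i <;> simp [contracted, hc]
  · rw [Finset.disjoint_left]
    intro i
    simp +contextual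

variable {t : Fin k → ℤ} (M : ∀ i, Finset (Fin (t i).natAbs))

variable (t) in
/-- The arc on the side `b` at the level `j` of the twist region `i`. -/
def levelArc (i : Fin k) (j : Fin ((t i).natAbs + 1)) (b : Bool) : G.PreArc t := .inl ⟨i, j, b⟩

theorem outerArc_eq (i : Fin k) (c : Fin 4) :
    G.outerArc t i c = G.levelArc t i (cornerArc (G.colour i) 0 (Fin.last (t i).natAbs) c).1
      (cornerArc (G.colour i) 0 (Fin.last (t i).natAbs) c).2 := rfl

theorem rightArc_true (i : Fin k) :
    G.rightArc t (i, true) = G.levelArc t i (Fin.last _) true := by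
  rcases hc : G.colour i <;> simp [rightArc, outerArc_eq, hc, cornerArc]

theorem rightArc_false (i : Fin k) : G.rightArc t (i, false) = G.levelArc t i 0 false := by
  rcases hc : G.colour i <;> simp [rightArc, outerArc_eq, hc, cornerArc]

theorem leftArc_eq (i : Fin k) (b : Bool) :
    G.leftArc t (i, b) = match G.colour i with
      | .chain => G.levelArc t i (if b then Fin.last _ else 0) !b
      | .sheaf => G.levelArc t i (if b then 0 else Fin.last _) b := by
  rcases hc : G.colour i <;> cases b <;> simp [leftArc, outerArc_eq, hc, cornerArc]

variable (t) in
/-- The crossing number `j` of the twist region `i`. -/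
def crossing (i : Fin k) (j : Fin (t i).natAbs) : (G.diagram t).X := ⟨i, j⟩

/-- The arc of `D_t` that contains a given arc of a twist region. -/
def toArc (a : G.PreArc t) : (G.diagram t).A := Quot.mk _ a

theorem diagram_arc_crossing (i : Fin k) (j : Fin (t i).natAbs) (c : Fin 4) :
    (G.diagram t).arc (G.crossing t i j) c = G.toArc (G.levelArc t i
      (cornerArc (G.colour i) j.castSucc j.succ (if 0 < t i then c else c + 1)).1
      (cornerArc (G.colour i) j.castSucc j.succ (if 0 < t i then c else c + 1)).2) := rfl

theorem crossing_mem_cutState (i : Fin k) (j : Fin (t i).natAbs) :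
    G.crossing t i j ∈ G.cutState t M ↔ (G.signedTwist t i < 0 ↔ j ∈ M i) := by
  refine Finset.mem_sigma.trans ?_
  change (i ∈ Finset.univ ∧ j ∈ if G.signedTwist t i < 0 then M i else (M i)ᶜ) ↔ _
  by_cases h : G.signedTwist t i < 0 <;> simp [h]

/-- Whatever the colour and the sign of an edge, a cut joins the two sides of the twist region at the
levels before and after the crossing, and the other smoothing joins these levels on each side. -/
theorem joined_cutState_imp_eq_iff {β : Type*} (f : (G.diagram t).A → β) :
    (∀ a b, (G.diagram t).Joined (G.cutState t M) a b → f a = f b) ↔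
      ∀ i (j : Fin (t i).natAbs),
        (j ∈ M i → f (G.toArc (G.levelArc t i j.castSucc true)) =
            f (G.toArc (G.levelArc t i j.castSucc false)) ∧
          f (G.toArc (G.levelArc t i j.succ true)) =
            f (G.toArc (G.levelArc t i j.succ false))) ∧
        (j ∉ M i → ∀ b, f (G.toArc (G.levelArc t i j.castSucc b)) =
          f (G.toArc (G.levelArc t i j.succ b))) := by
  have hsigma : ∀ p : (G.diagram t).X → Prop, (∀ x, p x) ↔ ∀ i j, p (G.crossing t i j) :=
    fun p => Sigma.forall
  rw [PDCode.joined_imp_eq_iff, hsigma]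
  refine forall_congr' fun i => forall_congr' fun j => ?_
  have ht : t i ≠ 0 := Int.natAbs_pos.1 j.pos
  simp only [diagram_arc_crossing, crossing_mem_cutState]
  rcases hc : G.colour i <;> rcases ht.lt_or_gt with hlt | hlt <;> by_cases hj : j ∈ M i <;>
    simp [cornerArc, signedTwist, hc, hlt, hlt.not_gt, hj, Bool.forall_bool] <;>
    grind

/-- The number of elements of `M` below the level `j`. -/
def cutsBelow {n : ℕ} (M : Finset (Fin n)) (j : Fin (n + 1)) : ℕ :=
  (M.filter fun x => x.castSucc < j).card

theorem cutsBelow_zero {n : ℕ} (M : Finset (Fin n)) : cutsBelow M 0 = 0 := by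
  simp [cutsBelow]

theorem cutsBelow_last {n : ℕ} (M : Finset (Fin n)) : cutsBelow M (Fin.last n) = M.card := by
  simp [cutsBelow, Fin.castSucc_lt_last]

theorem cutsBelow_le {n : ℕ} (M : Finset (Fin n)) (j : Fin (n + 1)) : cutsBelow M j ≤ M.card :=
  Finset.card_filter_le _ _

theorem cutsBelow_succ_of_notMem {n : ℕ} {M : Finset (Fin n)} {j : Fin n} (hj : j ∉ M) :
    cutsBelow M j.succ = cutsBelow M j.castSucc := by
  unfold cutsBelow
  congr 1
  refine Finset.filter_congr fun x hx => ?_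
  have : x ≠ j := fun h => hj (h ▸ hx)
  rw [Fin.castSucc_lt_succ_iff, Fin.castSucc_lt_castSucc_iff]
  exact ⟨fun h => lt_of_le_of_ne h this, le_of_lt⟩

theorem cutsBelow_succ_of_mem {n : ℕ} {M : Finset (Fin n)} {j : Fin n} (hj : j ∈ M) :
    cutsBelow M j.succ = cutsBelow M j.castSucc + 1 := by
  unfold cutsBelow
  rw [← Finset.card_insert_of_notMem (a := j) (by simp)]
  congr 1
  ext x
  simp only [Finset.mem_filter, Finset.mem_insert, Fin.castSucc_lt_succ_iff,
    Fin.castSucc_lt_castSucc_iff, le_iff_eq_or_lt]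
  constructor
  · rintro ⟨h1, h2 | h2⟩
    exacts [Or.inl h2, Or.inr ⟨h1, h2⟩]
  · rintro (rfl | ⟨h1, h2⟩)
    exacts [⟨hj, Or.inl rfl⟩, ⟨h1, Or.inr h2⟩]

theorem exists_cutsBelow_eq {n : ℕ} (M : Finset (Fin n)) {c : ℕ} (hc : c ≤ M.card) :
    ∃ j, cutsBelow M j = c := by
  have key : ∀ j : Fin (n + 1), ∀ c ≤ cutsBelow M j, ∃ j', cutsBelow M j' = c := by
    intro j
    induction j using Fin.induction with
    | zero =>
      intro c hc
      rw [cutsBelow_zero] at hc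
      exact ⟨0, by rw [cutsBelow_zero]; omega⟩
    | succ j ih =>
      intro c hc
      by_cases hj : j ∈ M
      · rw [cutsBelow_succ_of_mem hj] at hc
        rcases Nat.le_succ_iff.1 hc with h | h
        · exact ih c h
        · exact ⟨j.succ, by rw [cutsBelow_succ_of_mem hj, h]⟩
      · rw [cutsBelow_succ_of_notMem hj] at hc
        exact ih c hc
  exact key (Fin.last n) c (by rwa [cutsBelow_last])

/-- A labelling of the arcs of a twist region that is constant along the circles of the state with
cuts `M` depends, on each side of the region, only on the number of cuts below. -/
theorem label_eq_of_cutsBelow_eq {n : ℕ} {M : Finset (Fin n)} {β : Type*}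
    {f : Fin (n + 1) → Bool → β}
    (hthrough : ∀ j ∉ M, ∀ b, f j.castSucc b = f j.succ b) {j j' : Fin (n + 1)}
    (h : cutsBelow M j = cutsBelow M j') (b : Bool) : f j b = f j' b := by
  wlog hle : j ≤ j' generalizing j j'
  · exact (this h.symm (le_of_not_ge hle)).symm
  induction j' using Fin.induction with
  | zero => rw [Fin.le_zero_iff.1 hle]
  | succ j' ih =>
    rcases hle.lt_or_eq with hlt | rfl
    · have hle' : j ≤ j'.castSucc := Fin.le_castSucc_iff.2 hlt
      have hmono : cutsBelow M j ≤ cutsBelow M j'.castSucc :=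
        Finset.card_le_card (Finset.monotone_filter_right _ fun x _ hx => lt_of_lt_of_le hx hle')
      have hj' : j' ∉ M := by
        intro hmem
        rw [cutsBelow_succ_of_mem hmem] at h
        omega
      rw [ih (h.trans (cutsBelow_succ_of_notMem hj')) hle', hthrough j' hj']
    · rfl

/-- Every circle through a twist region that is cut across visits both sides of each of its levels
in the region. -/
theorem label_true_eq_false {n : ℕ} {M : Finset (Fin n)} {β : Type*}
    {f : Fin (n + 1) → Bool → β}
    (hcut : ∀ j ∈ M, f j.castSucc true = f j.castSucc false ∧ f j.succ true = f j.succ false)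
    (hthrough : ∀ j ∉ M, ∀ b, f j.castSucc b = f j.succ b) (hM : M.Nonempty) (j : Fin (n + 1)) :
    f j true = f j false := by
  rcases Nat.eq_zero_or_pos (cutsBelow M j) with h0 | hpos
  · -- Below all cuts, compare with the level under the lowest cut.
    obtain ⟨x, hx, hmin⟩ := M.exists_min_image id hM
    have hx0 : cutsBelow M x.castSucc = 0 := by
      rw [cutsBelow, Finset.card_eq_zero, Finset.filter_eq_empty_iff]
      intro y hy
      simpa using hmin y hy
    rw [label_eq_of_cutsBelow_eq hthrough (h0.trans hx0.symm),
      label_eq_of_cutsBelow_eq hthrough (h0.trans hx0.symm), (hcut x hx).1]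
  · -- Otherwise, compare with the level over the highest cut below `j`.
    obtain ⟨x, hx, hmax⟩ := (M.filter fun x => x.castSucc < j).exists_max_image id
      (Finset.card_pos.1 (show 0 < (M.filter fun x => x.castSucc < j).card from hpos))
    rw [Finset.mem_filter] at hx
    have hxj : cutsBelow M j = cutsBelow M x.succ := by
      unfold cutsBelow
      congr 1
      refine Finset.filter_congr fun y hy => ⟨fun h => ?_, fun h => ?_⟩
      · exact Fin.castSucc_lt_succ_iff.2 (hmax y (Finset.mem_filter.2 ⟨hy, h⟩))
      · exact lt_of_le_of_lt (Fin.castSucc_le_castSucc_iff.2 (Fin.castSucc_lt_succ_iff.1 h)) hx.2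
    rw [label_eq_of_cutsBelow_eq hthrough hxj,
      label_eq_of_cutsBelow_eq hthrough hxj, (hcut x hx.1).2]

variable (t) in
/-- The possible circles of a state: the boundary circles of the contracted subgraph, and the
circles between neighbouring cuts of a twist region. -/
abbrev CircleLabel (M : ∀ i, Finset (Fin (t i).natAbs)) : Type :=
  (Quotient (SameCycle.setoid (G.boundaryPerm (G.contracted {i | (M i).Nonempty}))) ⊕
    {v : V // ∀ a, G.vert a ≠ v}) ⊕ Σ i, Fin ((M i).card - 1)

/-- The boundary circle along the right side of a dart. -/
def boundaryLabel (h : Fin k × Bool) : G.CircleLabel t M := .inl (.inl (Quotient.mk _ h))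

theorem boundaryLabel_boundaryPerm (h : Fin k × Bool) :
    G.boundaryLabel M (G.boundaryPerm (G.contracted {i | (M i).Nonempty}) h) =
      G.boundaryLabel M h :=
  congrArg (fun q => Sum.inl (Sum.inl q))
    (Quotient.sound (sameCycle_apply_left.2 (SameCycle.refl _ _)))

/-- The circle through the arc on the side `b` at the level `j` of the twist region `i`. -/
def levelLabel (i : Fin k) (j : Fin ((t i).natAbs + 1)) (b : Bool) : G.CircleLabel t M :=
  if M i = ∅ then G.boundaryLabel M (i, b)
  else if h0 : cutsBelow (M i) j = 0 then G.boundaryLabel M (i, false)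
  else if h : cutsBelow (M i) j < (M i).card then
    .inr ⟨i, ⟨cutsBelow (M i) j - 1, by omega⟩⟩
  else G.boundaryLabel M (i, true)

/-- The circle through an arc of a twist region or through an isolated closed curve. -/
def preLabel : G.PreArc t → G.CircleLabel t M :=
  Sum.elim (fun a => G.levelLabel M a.1 a.2.1 a.2.2) fun v => .inl (.inr v)

theorem levelLabel_zero (i : Fin k) : G.levelLabel M i 0 false = G.boundaryLabel M (i, false) := by
  simp [levelLabel, cutsBelow_zero]

theorem levelLabel_last (i : Fin k) :
    G.levelLabel M i (Fin.last _) true = G.boundaryLabel M (i, true) := by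
  by_cases h : M i = ∅ <;> simp [levelLabel, cutsBelow_last, h]

theorem preLabel_levelArc (i : Fin k) (j : Fin ((t i).natAbs + 1)) (b : Bool) :
    G.preLabel M (G.levelArc t i j b) = G.levelLabel M i j b := rfl

/-- The arc on the right of a dart keeps its boundary circle whether the twist region is cut or
not. -/
theorem preLabel_rightArc (h : Fin k × Bool) :
    G.preLabel M (G.rightArc t h) = G.boundaryLabel M h := by
  obtain ⟨i, b⟩ := h
  cases b
  · rw [rightArc_false, preLabel_levelArc, levelLabel_zero]
  · rw [rightArc_true, preLabel_levelArc, levelLabel_last]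

/-- The arc on the left of a dart runs on along the right side of the same dart if the edge is
deleted, and of the opposite dart if the edge is contracted. -/
theorem preLabel_leftArc (h : Fin k × Bool) :
    G.preLabel M (G.leftArc t h) =
      G.boundaryLabel M (flipOn (G.contracted {i | (M i).Nonempty}) h) := by
  obtain ⟨i, b⟩ := h
  rcases hc : G.colour i <;> cases b <;> by_cases hM : M i = ∅ <;>
    simp [leftArc_eq, preLabel_levelArc, levelLabel, cutsBelow_zero, cutsBelow_last, flipOn_apply,
      contracted, hc, hM, Finset.nonempty_iff_ne_empty]

theorem preLabel_eq_of_glue {a b : G.PreArc t} (h : G.Glue t a b) :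
    G.preLabel M a = G.preLabel M b := by
  obtain ⟨h, rfl, rfl⟩ := h
  rw [preLabel_leftArc, preLabel_rightArc, ← G.boundaryLabel_boundaryPerm, boundaryPerm, mul_apply,
    flipOn_flipOn]

/-- The circle through an arc of `D_t`. -/
def arcLabel : (G.diagram t).A → G.CircleLabel t M :=
  Quot.lift (G.preLabel M) fun _ _ => G.preLabel_eq_of_glue M

theorem arcLabel_eq_of_joined (a b : (G.diagram t).A)
    (h : (G.diagram t).Joined (G.cutState t M) a b) : G.arcLabel M a = G.arcLabel M b := by
  refine (G.joined_cutState_imp_eq_iff M (G.arcLabel M)).2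
    (fun i j => ⟨fun hj => ?_, fun hj b => ?_⟩) a b h
  · change G.levelLabel M i _ _ = G.levelLabel M i _ _ ∧
      G.levelLabel M i _ _ = G.levelLabel M i _ _
    have hM : M i ≠ ∅ := fun h => by simp [h] at hj
    simp only [levelLabel, hM, if_false, and_self]
  · change G.levelLabel M i _ _ = G.levelLabel M i _ _
    simp only [levelLabel, cutsBelow_succ_of_notMem hj]

/-- The circle of a state that contains a given arc of a twist region. -/
def toCircle (a : G.PreArc t) : Quot ((G.diagram t).Joined (G.cutState t M)) :=
  Quot.mk _ (G.toArc a)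

theorem toCircle_glue (h : Fin k × Bool) :
    G.toCircle M (G.leftArc t h) = G.toCircle M (G.rightArc t (G.rot h)) :=
  congrArg (Quot.mk _) (Quot.sound ⟨h, rfl, rfl⟩)

theorem toCircle_levelArc (i : Fin k) (j : Fin (t i).natAbs) :
    (j ∈ M i → G.toCircle M (G.levelArc t i j.castSucc true) =
        G.toCircle M (G.levelArc t i j.castSucc false) ∧
      G.toCircle M (G.levelArc t i j.succ true) = G.toCircle M (G.levelArc t i j.succ false)) ∧
    (j ∉ M i → ∀ b, G.toCircle M (G.levelArc t i j.castSucc b) =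
      G.toCircle M (G.levelArc t i j.succ b)) :=
  (G.joined_cutState_imp_eq_iff M (Quot.mk _)).1 (fun _ _ h => Quot.sound h) i j

theorem toCircle_eq_of_cutsBelow_eq {i : Fin k} {j j' : Fin ((t i).natAbs + 1)}
    (h : cutsBelow (M i) j = cutsBelow (M i) j') (b : Bool) :
    G.toCircle M (G.levelArc t i j b) = G.toCircle M (G.levelArc t i j' b) :=
  label_eq_of_cutsBelow_eq (f := fun j b => G.toCircle M (G.levelArc t i j b))
    (fun j => (G.toCircle_levelArc M i j).2) h b

theorem toCircle_true_eq_false {i : Fin k} (hM : (M i).Nonempty) (j : Fin ((t i).natAbs + 1)) :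
    G.toCircle M (G.levelArc t i j true) = G.toCircle M (G.levelArc t i j false) :=
  label_true_eq_false (f := fun j b => G.toCircle M (G.levelArc t i j b))
    (fun j => (G.toCircle_levelArc M i j).1) (fun j => (G.toCircle_levelArc M i j).2) hM j

theorem toCircle_side_eq {i : Fin k} (hM : (M i).Nonempty) (j : Fin ((t i).natAbs + 1))
    (b b' : Bool) :
    G.toCircle M (G.levelArc t i j b) = G.toCircle M (G.levelArc t i j b') := by
  have := G.toCircle_true_eq_false M hM j
  cases b <;> cases b' <;> simp [this]

theorem toCircle_leftArc (h : Fin k × Bool) :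
    G.toCircle M (G.leftArc t (flipOn (G.contracted {i | (M i).Nonempty}) h)) =
      G.toCircle M (G.rightArc t h) := by
  obtain ⟨i, b⟩ := h
  have hr : G.rightArc t (i, b) = G.levelArc t i (if b then Fin.last _ else 0) b := by
    cases b
    · exact G.rightArc_false i
    · exact G.rightArc_true i
  by_cases hM : (M i).Nonempty
  · rw [hr]
    rcases hc : G.colour i <;> cases b <;>
      simp [flipOn_apply, contracted, hc, hM, leftArc_eq, G.toCircle_side_eq M hM _ true false]
  · have hM' : M i = ∅ := Finset.not_nonempty_iff_eq_empty.1 hM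
    have key : ∀ j j' b, G.toCircle M (G.levelArc t i j b) = G.toCircle M (G.levelArc t i j' b) :=
      fun j j' b => G.toCircle_eq_of_cutsBelow_eq M (by simp [cutsBelow, hM']) b
    rw [hr, key _ 0]
    rcases hc : G.colour i <;> cases b <;>
      simp [flipOn_apply, contracted, hc, hM', leftArc_eq, key (Fin.last _) 0]

theorem toCircle_boundaryPerm (h : Fin k × Bool) :
    G.toCircle M (G.rightArc t (G.boundaryPerm (G.contracted {i | (M i).Nonempty}) h)) =
      G.toCircle M (G.rightArc t h) := by
  rw [boundaryPerm, mul_apply, ← toCircle_glue, toCircle_leftArc]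

/-- A level between the cuts number `c` and `c + 1` of a twist region. -/
noncomputable def middleLevel (i : Fin k) (c : Fin ((M i).card - 1)) : Fin ((t i).natAbs + 1) :=
  (exists_cutsBelow_eq (M i) (c := c + 1) (by omega)).choose

theorem cutsBelow_middleLevel (i : Fin k) (c : Fin ((M i).card - 1)) :
    cutsBelow (M i) (middleLevel M i c) = c + 1 :=
  (exists_cutsBelow_eq (M i) (c := c + 1) (by omega)).choose_spec

/-- The circle with a given label. -/
noncomputable def labelCircle : G.CircleLabel t M → Quot ((G.diagram t).Joined (G.cutState t M)) :=
  Sum.elim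
    (Sum.elim
      (Quotient.lift (fun h => G.toCircle M (G.rightArc t h)) fun _ _ h =>
        TwistBracket.SameCycle.apply_eq (f := fun h => G.toCircle M (G.rightArc t h))
          (G.toCircle_boundaryPerm M) h)
      fun v => G.toCircle M (.inr v))
    fun c => G.toCircle M (G.levelArc t c.1 (middleLevel M c.1 c.2) true)

theorem labelCircle_levelLabel (i : Fin k) (j : Fin ((t i).natAbs + 1)) (b : Bool) :
    G.labelCircle M (G.levelLabel M i j b) = G.toCircle M (G.levelArc t i j b) := by
  unfold levelLabel
  split_ifs with h1 h2 h3
  · change G.toCircle M (G.rightArc t (i, b)) = _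
    cases b
    · rw [rightArc_false]
      exact G.toCircle_eq_of_cutsBelow_eq M (by simp [cutsBelow, h1]) _
    · rw [rightArc_true]
      exact G.toCircle_eq_of_cutsBelow_eq M (by simp [cutsBelow, h1]) _
  · change G.toCircle M (G.rightArc t (i, false)) = _
    rw [rightArc_false, G.toCircle_side_eq M (Finset.nonempty_iff_ne_empty.2 h1) _ false b]
    exact G.toCircle_eq_of_cutsBelow_eq M ((cutsBelow_zero _).trans h2.symm) _
  · change G.toCircle M (G.levelArc t i _ true) = _
    rw [G.toCircle_side_eq M (Finset.nonempty_iff_ne_empty.2 h1) _ true b]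
    refine G.toCircle_eq_of_cutsBelow_eq M ?_ _
    rw [cutsBelow_middleLevel]
    dsimp only
    omega
  · change G.toCircle M (G.rightArc t (i, true)) = _
    rw [rightArc_true, G.toCircle_side_eq M (Finset.nonempty_iff_ne_empty.2 h1) _ true b]
    refine G.toCircle_eq_of_cutsBelow_eq M ?_ _
    have := cutsBelow_le (M i) j
    rw [cutsBelow_last]
    omega

/-- The circles of a state are the boundary circles of the contracted subgraph, and between the cuts
of each twist region one circle less than there are cuts. -/
theorem circles_cutState :
    (G.diagram t).circles (G.cutState t M) =
      G.numBoundary (G.contracted {i | (M i).Nonempty}) + ∑ i, ((M i).card - 1) := by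
  have hcard : Nat.card (G.CircleLabel t M) =
      G.numBoundary (G.contracted {i | (M i).Nonempty}) + ∑ i, ((M i).card - 1) := by
    rw [Nat.card_sum, Nat.card_sum, Nat.card_sigma]
    simp [numBoundary, numCycles]
  rw [← hcard]
  refine Nat.card_congr ⟨Quot.lift (G.arcLabel M) (G.arcLabel_eq_of_joined M), G.labelCircle M,
    ?_, ?_⟩
  · rintro ⟨⟨⟨i, j, b⟩ | v⟩⟩
    · exact G.labelCircle_levelLabel M i j b
    · rfl
  · rintro ((q | v) | ⟨i, c⟩)
    · induction q using Quotient.ind with | _ h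
      exact G.preLabel_rightArc M h
    · rfl
    · change G.levelLabel M i (middleLevel M i c) true = _
      have hj := cutsBelow_middleLevel M i c
      have hM : M i ≠ ∅ := fun h => by
        have hc := c.2
        simp [h] at hc
      unfold levelLabel
      rw [if_neg hM, dif_neg (by omega), dif_pos (by omega)]
      congr 3
      omega

end ColouredPlaneGraph

/-! ### The state sum -/

open LaurentPolynomial in
/-- The contribution of the states of a twist region with `n` crossings that cut it across, relative
to the state without cuts: `m` cuts change the exponent of `A` by `-2 m` (by `2 m` if `r < 0`) and
enclose `m - 1` circles. Only the sign of `r` matters. -/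
noncomputable def cutSum (r : ℤ) (n : ℕ) : ℤ[T;T⁻¹] :=
  ∑ M : Finset (Fin n) with M.Nonempty,
    T ((if r < 0 then 2 else -2) * (M.card : ℤ)) * d ^ (M.card - 1)

open LaurentPolynomial in
theorem T_pow_eq_T_mul (a : ℤ) (n : ℕ) : (T a : ℤ[T;T⁻¹]) ^ n = T (a * n) := by
  rw [T_pow, mul_comm]

open LaurentPolynomial in
/-- The binomial theorem for `(1 + A ^ (∓ 2) * d) ^ n = (-A ^ (∓ 4)) ^ n`. -/
theorem d_mul_cutSum (r : ℤ) : d * cutSum r r.natAbs = twistPower r - 1 := by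
  set u : ℤ := if r < 0 then 2 else -2 with hu
  have hbase : T u * d + 1 = -(T (2 * u) : ℤ[T;T⁻¹]) := by
    rw [hu]
    split_ifs <;> rw [d, mul_sub, mul_neg, ← T_add, ← T_add] <;> (norm_num; try ring)
  have htwist : twistPower r = (T u * d + 1) ^ r.natAbs := by
    rw [hbase, neg_pow, T_pow_eq_T_mul, twistPower]
    have hexp : 2 * u * (r.natAbs : ℤ) = -4 * r := by
      rw [hu]
      split_ifs <;> omega
    rw [hexp]
    congr 1
    rw [← Int.negOnePow_abs, ← Int.natCast_natAbs, Int.coe_negOnePow_natCast]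
    simp
  have hsum := Fintype.sum_pow_mul_eq_add_pow (Fin r.natAbs) (T u * d) (1 : ℤ[T;T⁻¹])
  rw [Fintype.card_fin] at hsum
  rw [htwist, ← hsum, cutSum, Finset.mul_sum,
    ← Finset.sum_filter_add_sum_filter_not Finset.univ fun M : Finset (Fin r.natAbs) => M.Nonempty]
  have hempty : (Finset.univ.filter fun M : Finset (Fin r.natAbs) => ¬ M.Nonempty) = {∅} := by
    ext M
    simp [Finset.not_nonempty_iff_eq_empty]
  rw [hempty, Finset.sum_singleton, Finset.card_empty, pow_zero, one_pow, one_mul,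
    add_sub_cancel_right]
  refine Finset.sum_congr rfl fun M hM => ?_
  obtain ⟨m, hm⟩ := Nat.exists_eq_succ_of_ne_zero
    (Finset.card_pos.2 (Finset.mem_filter.1 hM).2).ne'
  rw [one_pow, mul_one, mul_pow, T_pow_eq_T_mul, hm, Nat.succ_sub_one, pow_succ d m]
  ring

namespace ColouredPlaneGraph

open LaurentPolynomial

variable {k : ℕ} {V : Type} [Fintype V] (G : ColouredPlaneGraph k V)

theorem natAbs_signedTwist (t : Fin k → ℤ) (i : Fin k) :
    (G.signedTwist t i).natAbs = (t i).natAbs := by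
  rcases hc : G.colour i <;> simp [signedTwist, hc]

theorem cutState_bijective (t : Fin k → ℤ) : Function.Bijective (G.cutState t) := by
  classical
  constructor
  · intro M M' h
    ext i j
    have h1 := G.crossing_mem_cutState M i j
    rw [h, G.crossing_mem_cutState M' i j] at h1
    tauto
  · intro S
    refine ⟨fun i => {j | G.signedTwist t i < 0 ↔ G.crossing t i j ∈ S}, ?_⟩
    ext x
    obtain ⟨i, j⟩ := x
    refine (G.crossing_mem_cutState _ i j).trans ?_
    rw [Finset.mem_filter_univ]
    change _ ↔ G.crossing t i j ∈ S
    tauto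

/-- The exponent of `A` in the contribution of a state. -/
theorem two_mul_card_cutState_sub (t : Fin k → ℤ) (M : ∀ i, Finset (Fin (t i).natAbs)) :
    2 * ((G.cutState t M).card : ℤ) - Fintype.card (G.diagram t).X =
      ∑ i, G.signedTwist t i +
        ∑ i, (if G.signedTwist t i < 0 then 2 else -2) * ((M i).card : ℤ) := by
  have h1 : (G.cutState t M).card =
      ∑ i, (if G.signedTwist t i < 0 then M i else (M i)ᶜ).card := Finset.card_sigma _ _
  have h2 : Fintype.card (G.diagram t).X = ∑ i, (t i).natAbs :=
    Fintype.card_sigma.trans (by simp)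
  rw [h1, h2]
  push_cast
  rw [Finset.mul_sum, ← Finset.sum_sub_distrib, ← Finset.sum_add_distrib]
  refine Finset.sum_congr rfl fun i _ => ?_
  have h3 := G.natAbs_signedTwist t i
  have h4 : (M i).card ≤ (t i).natAbs := by simpa using (M i).card_le_univ
  rw [← Int.natCast_natAbs]
  split_ifs with h
  · omega
  · rw [Finset.card_compl, Fintype.card_fin]
    omega

theorem T_sum {ι : Type*} (s : Finset ι) (f : ι → ℤ) :
    (T (∑ i ∈ s, f i) : ℤ[T;T⁻¹]) = ∏ i ∈ s, T (f i) := by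
  classical
  induction s using Finset.induction_on with
  | empty => simp
  | insert i s hi ih => rw [Finset.sum_insert hi, Finset.prod_insert hi, T_add, ih]

/-- The state sum of `D_t`, grouped by the set `W` of the edges whose twist regions are cut across. -/
theorem bracket_diagram [Nonempty V] (t : Fin k → ℤ) :
    (G.diagram t).bracket = T (∑ i, G.signedTwist t i) *
      ∑ W : Finset (Fin k), d ^ (G.numBoundary (G.contracted W) - 1) *
        ∏ i ∈ W, cutSum (G.signedTwist t i) (t i).natAbs := by
  classical
  let w : ∀ i, Finset (Fin (t i).natAbs) → ℤ[T;T⁻¹] := fun i M =>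
    T ((if G.signedTwist t i < 0 then 2 else -2) * (M.card : ℤ)) * d ^ (M.card - 1)
  have hterm : ∀ M : ∀ i, Finset (Fin (t i).natAbs),
      T (2 * ((G.cutState t M).card : ℤ) - Fintype.card (G.diagram t).X) *
          d ^ ((G.diagram t).circles (G.cutState t M) - 1) =
        T (∑ i, G.signedTwist t i) *
          (d ^ (G.numBoundary (G.contracted {i | (M i).Nonempty}) - 1) * ∏ i, w i (M i)) := by
    intro M
    have hpos := G.numBoundary_pos (G.contracted {i | (M i).Nonempty})
    rw [two_mul_card_cutState_sub, circles_cutState, Nat.sub_add_comm hpos, T_add, T_sum _ fun i =>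
      (if G.signedTwist t i < 0 then 2 else -2) * ((M i).card : ℤ), pow_add,
      ← Finset.prod_pow_eq_pow_sum, Finset.prod_mul_distrib]
    ring
  have hfiber : ∀ W : Finset (Fin k),
      (Finset.univ.filter fun M : ∀ i, Finset (Fin (t i).natAbs) =>
        (Finset.univ.filter fun i => (M i).Nonempty) = W) =
      Fintype.piFinset fun i =>
        if i ∈ W then Finset.univ.filter fun M => M.Nonempty else {∅} := by
    intro W
    ext M
    simp only [Finset.mem_filter_univ, Fintype.mem_piFinset, Finset.ext_iff (s₂ := W)]
    refine forall_congr' fun i => ?_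
    by_cases hi : i ∈ W <;> simp [hi, Finset.not_nonempty_iff_eq_empty]
  rw [PDCode.bracket, ← (G.cutState_bijective t).sum_comp, Finset.sum_congr rfl fun M _ => hterm M,
    ← Finset.mul_sum, ← Finset.sum_fiberwise Finset.univ
      fun M : ∀ i, Finset (Fin (t i).natAbs) => Finset.univ.filter fun i => (M i).Nonempty]
  congr 1
  refine Finset.sum_congr rfl fun W _ => ?_
  calc _ = ∑ M : ∀ i, Finset (Fin (t i).natAbs)
          with (Finset.univ.filter fun i => (M i).Nonempty) = W,
          d ^ (G.numBoundary (G.contracted W) - 1) * ∏ i, w i (M i) := by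
        refine Finset.sum_congr rfl fun M hM => ?_
        rw [(Finset.mem_filter.1 hM).2]
    _ = _ := by
        rw [← Finset.mul_sum, hfiber, ← Finset.prod_univ_sum]
        congr 1
        rw [← Finset.prod_subset (Finset.subset_univ W)]
        · refine Finset.prod_congr rfl fun i hi => ?_
          rw [if_pos hi]
          rfl
        · intro i _ hi
          rw [if_neg hi]
          simp [w]

/-- The polynomial `P`: the edge `i ∈ W` contributes a factor `X i - 1`, which is `d` times the
contribution of the cut states of its twist region. The subtractions in the exponent of `d` do not
truncate, by `treeWeight_add_one_le`. -/
noncomputable def bracketPolynomial : MvPolynomial (Fin k) ℤ[T;T⁻¹] :=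
  ∑ W : Finset (Fin k),
    MvPolynomial.C (d ^ (G.maxTreeWeight + G.numBoundary (G.contracted W) - 1 - W.card)) *
      ∏ i ∈ W, (MvPolynomial.X i - 1)

theorem d_pow_mul_bracket_diagram (hG : G.Connected) (t : Fin k → ℤ) :
    d ^ G.maxTreeWeight * (G.diagram t).bracket =
      T (∑ i, G.signedTwist t i) *
        MvPolynomial.eval (fun i => twistPower (G.signedTwist t i)) G.bracketPolynomial := by
  have := hG.1
  rw [bracket_diagram, mul_left_comm, bracketPolynomial, map_sum, Finset.mul_sum]
  congr 1
  refine Finset.sum_congr rfl fun W _ => ?_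
  have hle := G.treeWeight_add_one_le hG (G.contracted W)
  rw [treeWeight_contracted] at hle
  have hpos := G.numBoundary_pos (G.contracted W)
  have hprod : ∏ i ∈ W, (twistPower (G.signedTwist t i) - 1) =
      d ^ W.card * ∏ i ∈ W, cutSum (G.signedTwist t i) (t i).natAbs := by
    rw [← Finset.prod_const, ← Finset.prod_mul_distrib]
    refine Finset.prod_congr rfl fun i _ => ?_
    rw [← G.natAbs_signedTwist t i, d_mul_cutSum]
  simp only [map_mul, MvPolynomial.eval_C, map_prod, map_sub, MvPolynomial.eval_X, map_one]
  rw [hprod, ← mul_assoc, ← mul_assoc, ← pow_add, ← pow_add]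
  congr 2
  omega

end ColouredPlaneGraph

end TwistBracket

theorem mainTheorem1 {k : ℕ} {V : Type} [Fintype V]
    (G : TwistBracket.ColouredPlaneGraph k V) (hG : G.Connected)
    (L : TwistBracket.Link) (D : TwistBracket.LinkDiagram) (hDL : D.link = L)
    (hmin : D.twistNumber = L.twistNumber) (hred : D.TwistReduced)
    (t₀ : Fin k → ℤ) (hD : G.IsTemplate t₀ D) :
    (∃ P : MvPolynomial (Fin k) ℤ[T;T⁻¹], ∀ t : Fin k → ℤ,
      TwistBracket.d ^ G.maxTreeWeight * (G.diagram t).bracket =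
        LaurentPolynomial.T (∑ i, G.signedTwist t i) *
          MvPolynomial.eval (fun i => TwistBracket.twistPower (G.signedTwist t i)) P) ∧
    G.maxTreeWeight ≤ L.twistNumber :=
  ⟨⟨G.bracketPolynomial, G.d_pow_mul_bracket_diagram hG⟩,
    hmin ▸ G.maxTreeWeight_le.trans (hD.le_twistNumber hred)⟩
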